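/- Let $R$ and $R'$ be finite chain rings (finite nonzero commutative rings whose ideals are totally ordered by inclusion), let $\ell$ and $\ell'$ be the nilpotency indices of their radicals (the least integers with $J(R)^{\ell}=0$ and $J(R')^{\ell'}=0$), and let $\rho:R\to R'$ be a surjective ring homomorphism. Let $F$ be the residue field of $R$ (and, via $\rho$, of $R'$) and $q=|F|$. Let $\lambda\in R^\times$, $\lambda'=\rho(\lambda)$, and let $t$ be the order of the residue class $\overline{\lambda}$ in $F^\times$. Let $\alpha,\alpha'$ be positive integers with $\alpha'\equiv\alpha\pmod t$ and $\gcd(\alpha,t)=1$. For a positive integer $n$, an $(R',R)$-linear $(\lambda',\lambda)$-constacyclic code of cycle length $(\alpha' n,\alpha n)$ (hence of ratio $\alpha'/\alpha$) is an $R[X]$-submodule $C$ of $\big(R'[X]/\langle X^{\alpha' n}-\lambda'\rangle\big)\times\big(R[X]/\langle X^{\alpha n}-\lambda\rangle\big)$, where $R[X]$ acts on the first factor through $\rho$. Its length is $\alpha' n\ell'+\alpha n\ell$, its rate is $\mathrm{R}(C)=\frac{\log_q|C|}{\alpha' n\ell'+\alpha n\ell}$, and its relative minimum distance is $\Delta(C)=\frac{\mathrm{w}(C)}{\alpha'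 n\ell'+\alpha n\ell}$, where $\mathrm{w}(C)$ is the minimum Hamming weight of the nonzero elements of $C$ (with $\mathrm{w}(0)=0$ for the zero code); the Hamming weight of an element is the number of nonzero coefficients of the two representatives of degrees less than $\alpha' n$ and $\alpha n$. For $x\in[0,1-q^{-1}]$ let $h_q(x)=x\log_q(q-1)-x\log_q x-(1-x)\log_q(1-x)$, with $0\log_q 0=0$. Theorem 4.2. Let $\delta\in(0,1-q^{-1})$ be such that $$\frac{\alpha'+\alpha}{2\min\{\alpha',\alpha\}}\,\delta\le 1-q^{-1}\qquad\text{and}\qquad h_q\!\left(\frac{\alpha'+\alpha}{2\min\{\alpha',\alpha\}}\,\delta\right)<\frac12 .$$ Then there are positive integers $n_1,n_2,\dots$ with $\gcd(n_i,qt)=1$ and, for each $i$, an $(R',R)$-linear $(\lambda',\lambda)$-constacyclic code $C_i$ of cycle length $(\alpha' n_i,\alpha n_i)$, such that the length of $C_i$ goes to infinity, $$\lim_{i\to\infty}\mathrm{R}(C_i)=\frac{1}{\alpha'\ell'+\alpha\ell},\qquad\text{and}\qquad \Delta(C_i)>\frac{\alpha'+\alpha}{\alpha'\ell'+\alpha\ell}\,\delta\quad\text{for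 all } i=1,2,\dots .$$ -/

import Mathlib

open Polynomial Filter Topology

/-- A finite chain ring: a finite nonzero commutative ring whose ideals are totally ordered by
inclusion. -/
class IsFiniteChainRing (R : Type*) [CommRing R] : Prop where
  finite : Finite R
  nontrivial : Nontrivial R
  ideal_total : ∀ I J : Ideal R, I ≤ J ∨ J ≤ I

/-- A finite chain ring is local, so that it has a residue field. -/
instance IsFiniteChainRing.isLocalRing (R : Type*) [CommRing R] [IsFiniteChainRing R] :
    IsLocalRing R := by
  have := IsFiniteChainRing.nontrivial (R := R)
  obtain ⟨M, hM⟩ := Ideal.exists_maximal R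
  refine IsLocalRing.of_unique_max_ideal ⟨M, hM, fun N hN => ?_⟩
  rcases IsFiniteChainRing.ideal_total N M with h | h
  · exact hN.eq_of_le hM.ne_top h
  · exact (hM.eq_of_le hN.ne_top h).symm

/-- The cardinality `q` of the residue field `F` of `R`. -/
noncomputable def residueCard (R : Type*) [CommRing R] [IsLocalRing R] : ℕ :=
  Nat.card (IsLocalRing.ResidueField R)

/-- The order of the residue class of the unit `lam` in the multiplicative group of the residue
field. -/
noncomputable def residueOrder {R : Type*} [CommRing R] [IsLocalRing R] (lam : Rˣ) : ℕ :=
  orderOf (Units.map (IsLocalRing.residue R : R →* IsLocalRing.ResidueField R) lam)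

/-- The nilpotency index `ℓ` of the radical `J` of the local ring `R`: the least `ℓ` such that
`J ^ ℓ = 0`. -/
noncomputable def radicalIndex (R : Type*) [CommRing R] [IsLocalRing R] : ℕ :=
  nilpotencyClass (IsLocalRing.maximalIdeal R)

/-- The `q`-ary entropy, which is `Real.qaryEntropy` with logarithms taken to the base `q`. -/
noncomputable def qEntropy (q : ℕ) (x : ℝ) : ℝ :=
  Real.qaryEntropy q x / Real.log q

theorem qEntropy_eq (q : ℕ) (x : ℝ) :
    qEntropy q x = x * Real.logb q (q - 1) - x * Real.logb q x
      - (1 - x) * Real.logb q (1 - x) := by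
  simp only [qEntropy, Real.qaryEntropy, Real.binEntropy, Real.logb, Real.log_inv]
  push_cast
  ring

/-- The quotient ring `R[X] / ⟨X ^ m - a⟩`. -/
abbrev ConstacyclicRing (R : Type*) [CommRing R] (a : R) (m : ℕ) : Type _ :=
  AdjoinRoot (X ^ m - C a : R[X])

/-- The word `(c_0, …, c_{m-1})` of an element `c_0 + c_1 X + ⋯ + c_{m-1} X ^ (m-1)` of
`R[X] / ⟨X ^ m - a⟩`, that is, the coefficients of its representative of degree less than `m`. -/
noncomputable def ConstacyclicRing.word {R : Type*} [CommRing R] {a : R} {m : ℕ}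
    (c : ConstacyclicRing R a m) (i : Fin m) : R :=
  (AdjoinRoot.modByMonicHom (monic_X_pow_sub_C a i.pos.ne') c).coeff i

/-- The `R[X]`-module `(R'[X] / ⟨X ^ m' - ρ a⟩) × (R[X] / ⟨X ^ m - a⟩)`. -/
def DoubleConstacyclicModule {R R' : Type*} [CommRing R] [CommRing R'] (ρ : R →+* R') (a : R)
    (m' m : ℕ) : Type _ :=
  ConstacyclicRing R' (ρ a) m' × ConstacyclicRing R a m

namespace DoubleConstacyclicModule

variable {R R' : Type*} [CommRing R] [CommRing R'] {ρ : R →+* R'} {a : R} {m' m : ℕ}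

noncomputable instance : AddCommGroup (DoubleConstacyclicModule ρ a m' m) :=
  inferInstanceAs (AddCommGroup (ConstacyclicRing R' (ρ a) m' × ConstacyclicRing R a m))

/-- `R[X]` acts on the first component through the coefficientwise homomorphism
`R[X] → R'[X]` induced by `ρ`. -/
noncomputable instance : Module R[X] (DoubleConstacyclicModule ρ a m' m) :=
  letI : Module R[X] (ConstacyclicRing R' (ρ a) m') :=
    Module.compHom _ ((AdjoinRoot.mk (X ^ m' - C (ρ a) : R'[X])).comp (Polynomial.mapRingHom ρ))
  letI : Module R[X] (ConstacyclicRing R a m) :=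
    Module.compHom _ (AdjoinRoot.mk (X ^ m - C a : R[X]))
  inferInstanceAs (Module R[X] (ConstacyclicRing R' (ρ a) m' × ConstacyclicRing R a m))

theorem smul_def (f : R[X]) (c : DoubleConstacyclicModule ρ a m' m) :
    f • c = (AdjoinRoot.mk (X ^ m' - C (ρ a) : R'[X]) (f.map ρ) * c.1,
      AdjoinRoot.mk (X ^ m - C a : R[X]) f * c.2) := rfl

open Classical in
/-- The Hamming weight of a pair: the number of nonzero entries of the two words together. -/
noncomputable def weight (c : DoubleConstacyclicModule ρ a m' m) : ℕ :=
  hammingNorm (ConstacyclicRing.word c.1) + hammingNorm (ConstacyclicRing.word c.2)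

end DoubleConstacyclicModule

/-- An `(R', R)`-linear `(ρ a, a)`-constacyclic code of cycle length `(m', m)`. -/
abbrev DoubleConstacyclicCode {R R' : Type*} [CommRing R] [CommRing R'] (ρ : R →+* R') (a : R)
    (m' m : ℕ) : Type _ :=
  Submodule R[X] (DoubleConstacyclicModule ρ a m' m)

namespace DoubleConstacyclicCode

variable {R R' : Type*} [CommRing R] [CommRing R'] {ρ : R →+* R'} {a : R} {m' m : ℕ}

/-- The minimum Hamming weight of the nonzero codewords (and `0` for the zero code). -/
noncomputable def minWeight (K : DoubleConstacyclicCode ρ a m' m) : ℕ :=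
  sInf {w | ∃ c ∈ K, c ≠ 0 ∧ c.weight = w}

variable [IsLocalRing R] [IsLocalRing R']

/-- The code length `m' ℓ' + m ℓ`. -/
noncomputable def length (_K : DoubleConstacyclicCode ρ a m' m) : ℕ :=
  m' * radicalIndex R' + m * radicalIndex R

/-- The relative minimum distance. -/
noncomputable def relDist (K : DoubleConstacyclicCode ρ a m' m) : ℝ :=
  (K.minWeight : ℝ) / (length K : ℝ)

/-- The rate. -/
noncomputable def rate (K : DoubleConstacyclicCode ρ a m' m) : ℝ :=
  Real.logb (residueCard R) (Nat.card K) / (length K : ℝ)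

end DoubleConstacyclicCode

/-!
The codes are one-generator codes over the residue field `F`, found by counting and then carried
into the socles of the two rings.

Let `n = p ^ (k + 1)` for an odd prime `p` prime to `q t`. Since `α n` is prime to `t`, the class of
`lam` is `ν ^ (α n)` for a power `ν` of itself, and then it is `ν ^ (α' n)` as well, because
`α' ≡ α` modulo `t`. With `μ = ν ^ n`, write `X ^ n - μ = g Φ`, where `g = X ^ (n / p) - ν ^ (n / p)`.
If `β` is a root of `Φ`, then `β / ν` has order exactly `n`, so lifting the exponent shows that every
irreducible factor of `Φ` has degree at least `n / q ^ (p - 1)` (`prime_pow_le_natDegree`). For fixed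
`p` and growing `k` the factor `Φ` thus has boundedly many divisors, and the ideals of
`F[X] / (X ^ n - μ)` generated by multiples of `g` are zero or of dimension linear in `n`.

For polynomials `a`, `b` consider the code of all pairs `(f a g, f b g)`. If `f` generates with `Φ`
the ideal of a divisor of codegree `d`, then any `d` cyclically consecutive coordinates determine a
codeword (`eq_zero_of_cyclic_window`), and a pair of relative weight at most `δ'` looks that light
through some window. The volume bound `q ^ (2 d h_q(δ'))` for Hamming balls
(`card_hammingNorm_le`) therefore bounds the number of pairs `(a, b)` spoiled by `f`. There are at
most `q ^ d` such `f` for each divisor, and since `h_q(δ') < 1 / 2` the sum of all these bounds is,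
for large `k`, less than the number of pairs (`exists_heavy_pair`). So some code of dimension
`deg Φ = n - n / p` has all nonzero weights above `2 n δ'`.

Multiplication by `(X ^ (α n) - μ ^ α) / (X ^ n - μ)` repeats a word `α` times up to nonzero factors,
and likewise for `α'` (`exists_repetition`); this costs the factor `(α' + α) / (2 min α' α)` between
`δ'` and `δ`. Multiplication by an element of `R` whose annihilator is the radical embeds `F` in `R`,
coefficientwise and without changing weights, and the same works for `R'`
(`exists_double_constacyclic_code`). Letting `p` tend to infinity gives the rate.
-/

/-! ### The volume of Hamming balls -/

/-- The weight enumerator of the full space of words over `F`. -/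
theorem sum_pow_hammingNorm {ι F : Type*} [Fintype ι] [DecidableEq ι] [Fintype F] [Zero F]
    [DecidableEq F] (r : ℝ) :
    ∑ x : ι → F, r ^ hammingNorm x = (1 + ((Fintype.card F : ℝ) - 1) * r) ^ Fintype.card ι := by
  have h1 : ∀ x : ι → F, r ^ hammingNorm x = ∏ i, if x i ≠ 0 then r else 1 := by
    intro x
    rw [Finset.prod_ite, Finset.prod_const, Finset.prod_const_one, mul_one]
    rfl
  have h2 : ∑ y : F, (if y ≠ 0 then r else 1) = 1 + ((Fintype.card F : ℝ) - 1) * r := by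
    rw [← Finset.add_sum_erase _ _ (Finset.mem_univ (0 : F)),
      Finset.sum_congr rfl (g := fun _ => r) (fun y hy => if_pos (Finset.ne_of_mem_erase hy)),
      Finset.sum_const, Finset.card_erase_of_mem (Finset.mem_univ _), Finset.card_univ,
      nsmul_eq_mul, Nat.cast_sub (Fintype.card_pos_iff.2 ⟨0⟩)]
    simp
  simp_rw [h1]
  rw [← h2, ← Finset.card_univ, ← Finset.prod_const, Finset.prod_univ_sum, Fintype.piFinset_univ]

/-- The entropy bound for the volume of a Hamming ball of relative radius `δ`, by Chernoff's
method: a word of weight at most `δ M` contributes at least `r ^ (δ M)` to the weight enumerator at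
`r ≤ 1`. -/
theorem card_hammingNorm_le {ι F : Type*} [Fintype ι] [DecidableEq ι] [Fintype F] [Zero F]
    [DecidableEq F] (hq : 2 ≤ Fintype.card F) {δ : ℝ} (hδ : 0 < δ)
    (hδ1 : δ ≤ 1 - 1 / (Fintype.card F : ℝ)) :
    ((Finset.univ.filter fun x : ι → F => (hammingNorm x : ℝ) ≤ δ * Fintype.card ι).card : ℝ) ≤
      (Fintype.card F : ℝ) ^ ((Fintype.card ι : ℝ) * qEntropy (Fintype.card F) δ) := by
  set q := Fintype.card F with hqdef
  set M := Fintype.card ι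
  have hq2 : (2 : ℝ) ≤ q := by exact_mod_cast hq
  have hlogq : Real.log q ≠ 0 := (Real.log_pos (by linarith)).ne'
  have hinv : 0 < 1 / (q : ℝ) := by positivity
  have h1δ : 0 < 1 - δ := by linarith
  have hq1 : 0 < (q : ℝ) - 1 := by linarith
  -- the value of `r` that minimizes `(1 + (q - 1) r) ^ M / r ^ (δ M)`
  set r : ℝ := δ / ((1 - δ) * (q - 1)) with hr
  have hr0 : 0 < r := by positivity
  have hr1 : r ≤ 1 := by
    rw [hr, div_le_one (by positivity)]
    have : δ * q ≤ (1 - 1 / (q : ℝ)) * q := by gcongr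
    rw [sub_mul, one_div, inv_mul_cancel₀ (by positivity)] at this
    nlinarith
  have hrlog : Real.log r = Real.log δ - Real.log (1 - δ) - Real.log (q - 1) := by
    rw [hr, Real.log_div hδ.ne' (by positivity), Real.log_mul h1δ.ne' hq1.ne']
    ring
  have hsum : (1 + ((q : ℝ) - 1) * r) = (1 - δ)⁻¹ := by
    rw [hr]; field_simp; ring
  have hcount : ((Finset.univ.filter fun x : ι → F => (hammingNorm x : ℝ) ≤ δ * M).card : ℝ) *
      r ^ (δ * M) ≤ ((1 - δ)⁻¹) ^ M := by
    rw [← hsum, hqdef, ← sum_pow_hammingNorm, ← nsmul_eq_mul, ← Finset.sum_const]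
    refine (Finset.sum_le_sum fun x hx => ?_).trans
      (Finset.sum_le_sum_of_subset_of_nonneg (Finset.filter_subset _ _) fun _ _ _ => by positivity)
    rw [← Real.rpow_natCast]
    exact Real.rpow_le_rpow_of_exponent_ge hr0 hr1 (Finset.mem_filter.1 hx).2
  rw [← le_div_iff₀ (by positivity)] at hcount
  refine hcount.trans (le_of_eq ?_)
  rw [← Real.rpow_natCast, Real.rpow_def_of_pos (by positivity), Real.rpow_def_of_pos hr0,
    Real.rpow_def_of_pos (by positivity), ← Real.exp_sub, qEntropy, Real.log_inv, hrlog]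
  congr 1
  rw [Real.qaryEntropy, Real.binEntropy, Real.log_inv, Real.log_inv]
  push_cast
  field_simp
  ring

/-! ### Windows of constacyclic codes -/

/-- Any `d` cyclically consecutive coordinates form an information set of the constacyclic code
generated by a divisor `G` of `X ^ n - μ` of codegree `d`. -/
theorem eq_zero_of_cyclic_window {F : Type*} [Field F] {n d : ℕ} (hn : 0 < n) {μ : F}
    (hμ : μ ≠ 0) {G : F[X]} (hG : G ∣ X ^ n - C μ) (hd : G.natDegree + d = n) (i : ℕ)
    {u : F[X]} (hu : u.degree < n) (hGu : G ∣ u)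
    (hw : ∀ j < d, u.coeff ((i + j) % n) = 0) : u = 0 := by
  -- Shift the window to the top coordinates, where it forces `deg u < deg G`. The induction is on
  -- the number `s` of shifts that remain, the top window being reached at `(i + 1) n - d`.
  have step : ∀ s, ∀ u : F[X], u.degree < n → G ∣ u →
      (∀ j < d, u.coeff (((i + 1) * n - d - s + j) % n) = 0) → s ≤ (i + 1) * n - d → u = 0 := by
    intro s
    have hle : d ≤ (i + 1) * n := by nlinarith
    induction s with
    | zero =>
      intro u hu hGu hw _
      refine Polynomial.eq_zero_of_dvd_of_degree_lt hGu ?_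
      have hG0 : G ≠ 0 := by
        rintro rfl
        exact (X_pow_sub_C_ne_zero hn μ) (zero_dvd_iff.1 hG)
      rw [degree_eq_natDegree hG0, degree_lt_iff_coeff_zero]
      intro m hm
      rcases lt_or_ge m n with hmn | hmn
      · have := hw (m - G.natDegree) (by omega)
        rwa [show (i + 1) * n - d - 0 + (m - G.natDegree) = m + n * i by
          rw [add_mul, one_mul, mul_comm] at *; omega, Nat.add_mul_mod_self_left,
          Nat.mod_eq_of_lt hmn] at this
      · exact coeff_eq_zero_of_degree_lt (hu.trans_le (by exact_mod_cast hmn))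
    | succ s ih =>
      intro u hu hGu hw hs
      -- `v` is the constacyclic shift of `u`
      set v : F[X] := X * u - C (u.coeff (n - 1)) * (X ^ n - C μ) with hv
      have hv0 : v.coeff 0 = μ * u.coeff (n - 1) := by
        simp [hv, hn.ne, mul_comm]
      have hvs : ∀ k, v.coeff (k + 1) = u.coeff k - if k + 1 = n then u.coeff (n - 1) else 0 := by
        intro k
        simp [hv, mul_sub, coeff_X_pow]
      have hvz : v = 0 := by
        refine ih v ?_ ?_ ?_ (by omega)
        · rw [degree_lt_iff_coeff_zero]
          intro m hm
          obtain ⟨k, rfl⟩ : ∃ k, m = k + 1 := ⟨m - 1, by omega⟩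
          rw [hvs]
          split_ifs with h
          · rw [← h]; simp
          · rw [sub_zero]
            exact coeff_eq_zero_of_degree_lt (hu.trans_le (by exact_mod_cast (by omega : n ≤ k)))
        · exact dvd_sub (hGu.mul_left _) (hG.mul_left _)
        · intro j hj
          have := hw j hj
          set y := (i + 1) * n - d - (s + 1) + j with hy
          have hys : (i + 1) * n - d - s + j = y + 1 := by omega
          rw [hys]
          have hyn := Nat.mod_lt y hn
          by_cases h : y % n + 1 = n
          · have : (y + 1) % n = 0 := by
              rw [← Nat.mod_add_mod, h, Nat.mod_self]
            rw [this, hv0, show n - 1 = y % n by omega]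
            simp_all
          · have h2 : (y + 1) % n = y % n + 1 := by
              rw [← Nat.mod_add_mod, Nat.mod_eq_of_lt (by omega)]
            rw [h2, hvs, if_neg h]
            simp_all
      ext k
      rw [coeff_zero]
      rcases lt_trichotomy (k + 1) n with hk | hk | hk
      · have := hvs k
        rw [hvz, if_neg (by omega)] at this
        simpa using this.symm
      · rw [hvz] at hv0
        have : u.coeff (n - 1) = 0 := by simpa [hμ] using hv0.symm
        rwa [← hk] at this
      · exact coeff_eq_zero_of_degree_lt (hu.trans_le (by exact_mod_cast (by omega : n ≤ k)))
  have hle : d ≤ n := by omega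
  have hi : i ≤ i * n := Nat.le_mul_of_pos_right i hn
  have hexp : (i + 1) * n = i * n + n := by ring
  refine step ((i + 1) * n - d - i) u hu hGu (fun j hj => ?_) (Nat.sub_le _ _)
  rw [Nat.sub_sub_self (by omega)]
  exact hw j hj

/-- Each coordinate is seen by exactly `d` of the `n` cyclic windows of length `d`. -/
theorem sum_card_cyclic_window {F : Type*} [Field F] [DecidableEq F] {n d : ℕ} (hn : 0 < n)
    {u : F[X]} (hu : u.degree < n) :
    ∑ i ∈ Finset.range n, hammingNorm (fun j : Fin d => u.coeff ((i + j) % n)) =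
      d * u.support.card := by
  have : NeZero n := ⟨hn.ne'⟩
  have h1 : ∀ i, hammingNorm (fun j : Fin d => u.coeff ((i + j) % n)) =
      ∑ j : Fin d, if u.coeff ((i + j) % n) ≠ 0 then 1 else 0 := fun i => by
    rw [hammingNorm, Finset.card_filter]
  have h2 : u.support.card = ∑ i : Fin n, if u.coeff i ≠ 0 then 1 else 0 := by
    rw [Fin.sum_univ_eq_sum_range (fun i => if u.coeff i ≠ 0 then 1 else 0), ← Finset.card_filter]
    congr 1
    ext k
    simp only [mem_support_iff, Finset.mem_filter, Finset.mem_range, ne_eq]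
    refine ⟨fun h => ⟨?_, h⟩, fun h => h.2⟩
    by_contra hk
    exact h (coeff_eq_zero_of_degree_lt (hu.trans_le (by exact_mod_cast not_lt.1 hk)))
  simp_rw [h1]
  rw [Finset.sum_comm]
  have h3 : ∀ j : Fin d, ∑ i ∈ Finset.range n, (if u.coeff ((i + j) % n) ≠ 0 then 1 else 0) =
      u.support.card := by
    intro j
    rw [h2, ← Fin.sum_univ_eq_sum_range (fun i => if u.coeff ((i + j) % n) ≠ 0 then 1 else 0),
      ← Equiv.sum_comp (Equiv.addRight (Fin.ofNat n j))
        (fun i : Fin n => if u.coeff i ≠ 0 then 1 else 0)]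
    refine Finset.sum_congr rfl fun i _ => ?_
    simp [Fin.val_add]
  rw [Finset.sum_congr rfl fun j _ => h3 j]
  simp

/-! ### Counting the pairs that give light codewords -/

/-- The finite set of polynomials of degree less than `D` over a finite field. -/
noncomputable def lowDegree (F : Type*) [Field F] [Finite F] (D : ℕ) : Finset F[X] :=
  (show (degreeLT F D : Set F[X]).Finite from
    have : Finite (degreeLT F D) := Finite.of_equiv _ (degreeLTEquiv F D).toEquiv.symm
    Set.toFinite _).toFinset

theorem mem_lowDegree {F : Type*} [Field F] [Finite F] {D : ℕ} {u : F[X]} :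
    u ∈ lowDegree F D ↔ u.degree < D := by
  simp [lowDegree, mem_degreeLT]

theorem card_lowDegree (F : Type*) [Field F] [Fintype F] (D : ℕ) :
    (lowDegree F D).card = Fintype.card F ^ D := by
  rw [lowDegree, ← Nat.card_eq_card_finite_toFinset]
  exact (Nat.card_congr (degreeLTEquiv F D).toEquiv).trans (by simp)

/-- At most `q ^ (D - deg e)` polynomials of degree less than `D` are multiples of `e`. The condition
`P` is only assumed to imply divisibility by `e`. -/
theorem card_filter_dvd_lowDegree_le {F : Type*} [Field F] [Fintype F] [DecidableEq F] {D : ℕ}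
    {e : F[X]} (he : e ≠ 0) (P : F[X] → Prop) [DecidablePred P] (hP : ∀ f, P f → e ∣ f) :
    ((lowDegree F D).filter P).card ≤ Fintype.card F ^ (D - e.natDegree) := by
  classical
  rw [← card_lowDegree]
  refine (Finset.card_le_card ?_).trans (Finset.card_image_le (f := fun x => e * x))
  intro f hf
  obtain ⟨hfD, hPf⟩ := Finset.mem_filter.1 hf
  obtain ⟨x, rfl⟩ := hP f hPf
  refine Finset.mem_image.2 ⟨x, ?_, rfl⟩
  rw [mem_lowDegree] at hfD ⊢
  by_cases hx : x = 0
  · simp [hx]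
  · rw [degree_eq_natDegree (mul_ne_zero he hx), natDegree_mul he hx] at hfD
    rw [degree_eq_natDegree hx]
    norm_cast at hfD ⊢
    omega

/-- The number of pairs `(a, b)` whose codewords look light through a fixed cyclic window. The
window has the dimension of the ideal generated by `f`, and is an information set of it, so each
pattern seen in the window comes from as many pairs as `(0, 0)` does. -/
theorem card_light_window_le {F : Type*} [Field F] [Fintype F] [DecidableEq F] {n : ℕ}
    (hn : 0 < n) {μ : F} (hμ : μ ≠ 0) {g Φ e c f f' : F[X]} (hN : X ^ n - C μ = g * Φ)
    (hΦ : Φ = e * c) (hf : f = e * f') (hcop : IsCoprime c f') (i : ℕ) (t : ℝ) :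
    ((lowDegree F Φ.natDegree ×ˢ lowDegree F Φ.natDegree).filter fun x =>
      ((hammingNorm (fun j : Fin c.natDegree =>
          ((f * x.1 * g) %ₘ (X ^ n - C μ)).coeff ((i + j) % n)) +
        hammingNorm (fun j : Fin c.natDegree =>
          ((f * x.2 * g) %ₘ (X ^ n - C μ)).coeff ((i + j) % n)) : ℕ) : ℝ) ≤ t).card ≤
    Fintype.card F ^ (2 * e.natDegree) *
      (Finset.univ.filter fun z : Fin c.natDegree ⊕ Fin c.natDegree → F =>
        (hammingNorm z : ℝ) ≤ t).card := by
  classical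
  have hmonic : (X ^ n - C μ).Monic := monic_X_pow_sub_C μ hn.ne'
  have hN0 : g * Φ ≠ 0 := hN ▸ hmonic.ne_zero
  have hg0 : g ≠ 0 := left_ne_zero_of_mul hN0
  have hΦ0 : e * c ≠ 0 := hΦ ▸ right_ne_zero_of_mul hN0
  have he0 : e ≠ 0 := left_ne_zero_of_mul hΦ0
  have hc0 : c ≠ 0 := right_ne_zero_of_mul hΦ0
  have hdeg : (e * g).natDegree + c.natDegree = n := by
    rw [← natDegree_mul (mul_ne_zero he0 hg0) hc0, mul_right_comm, ← hΦ, mul_comm, ← hN,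
      natDegree_X_pow_sub_C]
  set L : F[X] → Fin c.natDegree → F := fun x j =>
    ((f * x * g) %ₘ (X ^ n - C μ)).coeff ((i + j) % n) with hL
  have hLsub : ∀ x y, L (x - y) = L x - L y := by
    intro x y
    ext j
    simp only [hL, Pi.sub_apply]
    rw [mul_sub, sub_mul, sub_modByMonic, coeff_sub]
  have hLker : ∀ x, L x = 0 → c ∣ x := by
    intro x hx
    have hz : (f * x * g) %ₘ (X ^ n - C μ) = 0 := by
      refine eq_zero_of_cyclic_window (G := e * g) hn hμ ?_ hdeg i ?_ ?_ ?_
      · rw [hN, hΦ]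
        exact ⟨c, by ring⟩
      · have := degree_modByMonic_lt (f * x * g) hmonic
        rwa [degree_X_pow_sub_C hn] at this
      · rw [modByMonic_eq_sub_mul_div]
        refine dvd_sub ⟨f' * x, by rw [hf]; ring⟩ ?_
        rw [hN, hΦ]
        exact Dvd.dvd.mul_right ⟨c, by ring⟩ _
      · intro j hj
        exact congrFun hx ⟨j, hj⟩
    rw [modByMonic_eq_zero_iff_dvd hmonic, hN, mul_comm, mul_dvd_mul_iff_right hg0, hΦ, hf,
      mul_assoc, mul_dvd_mul_iff_left he0] at hz
    exact hcop.dvd_of_dvd_mul_left hz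
  set K := (lowDegree F Φ.natDegree).filter (c ∣ ·) with hK
  have hKcard : K.card ≤ Fintype.card F ^ e.natDegree := by
    have := card_filter_dvd_lowDegree_le (D := Φ.natDegree) hc0 (c ∣ ·) fun _ h => h
    rwa [hΦ, natDegree_mul he0 hc0, Nat.add_sub_cancel, ← natDegree_mul he0 hc0, ← hΦ] at this
  set m : F[X] × F[X] → (Fin c.natDegree ⊕ Fin c.natDegree → F) :=
    fun x => Sum.elim (L x.1) (L x.2) with hm
  have hmnorm : ∀ x, hammingNorm (m x) = hammingNorm (L x.1) + hammingNorm (L x.2) := by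
    intro x
    simp only [hammingNorm, Finset.card_filter, Fintype.sum_sum_type, hm, Sum.elim_inl,
      Sum.elim_inr]
    congr!
  refine (Finset.card_le_mul_card_image (f := m) _ (Fintype.card F ^ (2 * e.natDegree)) ?_).trans
    (Nat.mul_le_mul_left _ (Finset.card_le_card ?_))
  · intro z hz
    obtain ⟨x₀, hx₀, rfl⟩ := Finset.mem_image.1 hz
    have hx₀' := Finset.mem_product.1 (Finset.mem_filter.1 hx₀).1
    rw [mul_comm 2, pow_mul, sq]
    refine le_trans ?_ (Nat.mul_le_mul hKcard hKcard)
    rw [← Finset.card_product]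
    refine Finset.card_le_card_of_injOn (fun x => x - x₀) ?_ (sub_left_injective.injOn)
    intro x hx
    obtain ⟨hx1, hx2⟩ := Finset.mem_filter.1 (Finset.mem_coe.1 hx)
    have hx1' := Finset.mem_product.1 (Finset.mem_filter.1 hx1).1
    have hl : L x.1 = L x₀.1 := funext fun j => congrFun hx2 (Sum.inl j)
    have hr : L x.2 = L x₀.2 := funext fun j => congrFun hx2 (Sum.inr j)
    simp only [mem_lowDegree] at hx1' hx₀'
    simp only [Finset.coe_product, Set.mem_prod, Finset.mem_coe, hK, Finset.mem_filter,
      mem_lowDegree, Prod.fst_sub, Prod.snd_sub]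
    exact ⟨⟨(degree_sub_le _ _).trans_lt (max_lt hx1'.1 hx₀'.1),
      hLker _ (by rw [hLsub, hl, sub_self])⟩,
      ⟨(degree_sub_le _ _).trans_lt (max_lt hx1'.2 hx₀'.2),
      hLker _ (by rw [hLsub, hr, sub_self])⟩⟩
  · intro z hz
    obtain ⟨x, hx, rfl⟩ := Finset.mem_image.1 hz
    refine Finset.mem_filter.2 ⟨Finset.mem_univ _, ?_⟩
    rw [hmnorm]
    exact (Finset.mem_filter.1 hx).2

/-- A polynomial of degree at most `n` has at most `B` irreducible factors if each has degree at
least `n / B`. -/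
theorem card_normalizedFactors_le {F : Type*} [Field F] [DecidableEq F] {n B : ℕ} (hn : 0 < n)
    {Φ : F[X]} (hΦ0 : Φ ≠ 0) (hΦn : Φ.natDegree ≤ n)
    (hB : ∀ P : F[X], Irreducible P → P ∣ Φ → n ≤ B * P.natDegree) :
    (UniqueFactorizationMonoid.normalizedFactors Φ).card ≤ B := by
  set S := UniqueFactorizationMonoid.normalizedFactors Φ with hS
  have h1 : (S.map natDegree).sum = Φ.natDegree := by
    rw [← natDegree_multiset_prod _ (UniqueFactorizationMonoid.zero_notMem_normalizedFactors Φ)]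
    exact natDegree_eq_of_degree_eq (degree_eq_degree_of_associated
      (UniqueFactorizationMonoid.prod_normalizedFactors hΦ0))
  have h2 : S.card * n ≤ (S.map fun P => B * P.natDegree).sum := by
    have := Multiset.card_nsmul_le_sum (s := S.map fun P => B * P.natDegree) (a := n) (by
      intro x hx
      obtain ⟨P, hP, rfl⟩ := Multiset.mem_map.1 hx
      exact hB P (UniqueFactorizationMonoid.irreducible_of_normalized_factor P hP)
        (UniqueFactorizationMonoid.dvd_of_mem_normalizedFactors hP))
    simpa using this
  rw [Multiset.sum_map_mul_left, h1] at h2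
  exact Nat.le_of_mul_le_mul_right (h2.trans (Nat.mul_le_mul_left B hΦn)) hn

/-- The greatest common divisor of `f` and `Φ`, written as the product of a multiset of normalized
irreducible factors of `Φ`, so that it is one of at most `2 ^ B` polynomials when `Φ` has at most `B`
factors. The cofactor `c` of `Φ` is not a unit when `f` is nonzero modulo `Φ`. -/
theorem exists_gcd_factorization {F : Type*} [Field F] [DecidableEq F] {Φ f : F[X]}
    (hΦ0 : Φ ≠ 0) (hf : ¬ Φ ∣ f) :
    ∃ S ≤ UniqueFactorizationMonoid.normalizedFactors Φ, ∃ c f' : F[X], Φ = S.prod * c ∧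
      f = S.prod * f' ∧ IsCoprime c f' ∧ ¬ IsUnit c := by
  have hd0 : EuclideanDomain.gcd f Φ ≠ 0 := fun h => hΦ0 (EuclideanDomain.gcd_eq_zero_iff.1 h).2
  have hass := UniqueFactorizationMonoid.prod_normalizedFactors hd0
  have hbez := EuclideanDomain.gcd_eq_gcd_ab f Φ
  have h1 := EuclideanDomain.gcd_dvd_left f Φ
  have h2 := EuclideanDomain.gcd_dvd_right f Φ
  generalize EuclideanDomain.gcd f Φ = G at *
  refine ⟨UniqueFactorizationMonoid.normalizedFactors G,
    (UniqueFactorizationMonoid.dvd_iff_normalizedFactors_le_normalizedFactors hd0 hΦ0).1 h2, ?_⟩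
  generalize (UniqueFactorizationMonoid.normalizedFactors G).prod = e at *
  obtain ⟨c, hc⟩ := hass.dvd.trans h2
  obtain ⟨f', hf'⟩ := hass.dvd.trans h1
  refine ⟨c, f', hc, hf', ?_, ?_⟩
  · obtain ⟨u, hu⟩ := hass
    have he0 : e ≠ 0 := by rintro rfl; exact hd0 (by simpa using hu.symm)
    generalize EuclideanDomain.gcdA f Φ = x at *
    generalize EuclideanDomain.gcdB f Φ = y at *
    have : (u : F[X]) = y * c + x * f' := by
      apply mul_left_cancel₀ he0
      rw [hu, hbez, hf', hc]
      ring
    refine ⟨↑u⁻¹ * y, ↑u⁻¹ * x, ?_⟩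
    rw [mul_assoc, mul_assoc, ← mul_add, ← this, Units.inv_mul]
  · intro hu
    apply hf
    rw [hc, hf']
    obtain ⟨u, rfl⟩ := hu
    exact (Units.mul_right_dvd.2 dvd_rfl).mul_right f'

/-- The Gilbert–Varshamov argument for one-generator double constacyclic codes: when the
irreducible factors of `Φ` are few and large, some pair `(a, b)` makes every codeword
`(f a g, f b g)`, with `f` nonzero modulo `Φ`, heavy. -/
theorem exists_heavy_pair {F : Type*} [Field F] [Fintype F] [DecidableEq F] {n B : ℕ}
    (hn : 0 < n) (hB0 : 0 < B) {μ : F} (hμ : μ ≠ 0) {g Φ : F[X]} (hN : X ^ n - C μ = g * Φ)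
    (hB : ∀ P : F[X], Irreducible P → P ∣ Φ → n ≤ B * P.natDegree) {δ : ℝ} (hδ : 0 < δ)
    (hδ1 : δ ≤ 1 - 1 / (Fintype.card F : ℝ)) (hent : qEntropy (Fintype.card F) δ < 1 / 2)
    (hsmall : 2 ^ B * ((n : ℝ) *
      (Fintype.card F : ℝ) ^ (-(1 - 2 * qEntropy (Fintype.card F) δ) * (n / B))) < 1) :
    ∃ a b : F[X], ∀ f : F[X], ¬ Φ ∣ f → 2 * n * δ <
      ((((f * a * g) %ₘ (X ^ n - C μ)).support.card +
        ((f * b * g) %ₘ (X ^ n - C μ)).support.card : ℕ) : ℝ) := by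
  classical
  set q := Fintype.card F with hq
  set h := qEntropy q δ with hh
  have hq2 : 2 ≤ q := Fintype.one_lt_card
  have hq0 : (0 : ℝ) < q := by positivity
  have hq1 : (1 : ℝ) ≤ q := by exact_mod_cast (by omega : 1 ≤ q)
  set D := Φ.natDegree with hD
  have hmonic : (X ^ n - C μ).Monic := monic_X_pow_sub_C μ hn.ne'
  have hN0 : g * Φ ≠ 0 := hN ▸ hmonic.ne_zero
  have hg0 : g ≠ 0 := left_ne_zero_of_mul hN0
  have hΦ0 : Φ ≠ 0 := right_ne_zero_of_mul hN0
  have hDn : D ≤ n := by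
    have := congrArg natDegree hN
    rw [natDegree_X_pow_sub_C, natDegree_mul hg0 hΦ0] at this
    omega
  by_contra! hcon
  -- the divisors of `Φ` up to units
  set E : Finset F[X] :=
    ((UniqueFactorizationMonoid.normalizedFactors Φ).powerset.map Multiset.prod).toFinset with hE
  have hEcard : E.card ≤ 2 ^ B := by
    refine (Multiset.toFinset_card_le _).trans ?_
    rw [Multiset.card_map, Multiset.card_powerset]
    exact Nat.pow_le_pow_right (by norm_num) (card_normalizedFactors_le hn hΦ0 hDn hB)
  -- `Q e f`: the greatest common divisor of `f` and `Φ` is `e`, and `f` is nonzero modulo `Φ`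
  set Q : F[X] → F[X] → Prop := fun e f => ∃ c f' : F[X], Φ = e * c ∧ f = e * f' ∧
    IsCoprime c f' ∧ ¬ IsUnit c with hQ
  set T := lowDegree F D ×ˢ lowDegree F D with hT
  set W : ℕ → F[X] → ℕ → F[X] → ℕ := fun d f i x => hammingNorm (fun j : Fin d =>
    ((f * x * g) %ₘ (X ^ n - C μ)).coeff ((i + j) % n)) with hW
  -- the pairs for which the codeword of `f` is light in the window that starts at `i`
  set Bad : F[X] → F[X] → ℕ → Finset (F[X] × F[X]) := fun e f i => T.filter fun x =>
    ((W (D - e.natDegree) f i x.1 + W (D - e.natDegree) f i x.2 : ℕ) : ℝ) ≤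
      δ * (Fintype.card (Fin (D - e.natDegree) ⊕ Fin (D - e.natDegree))) with hBad
  have hdeg_mod : ∀ u : F[X], (u %ₘ (X ^ n - C μ)).degree < n := by
    intro u
    have := degree_modByMonic_lt u hmonic
    rwa [degree_X_pow_sub_C hn] at this
  have hcover : T ⊆ E.biUnion fun e => ((lowDegree F D).filter (Q e)).biUnion fun f =>
      (Finset.range n).biUnion fun i => Bad e f i := by
    intro x hx
    obtain ⟨f₀, hf₀, hle⟩ := hcon x.1 x.2
    obtain ⟨f, hfdeg, hfdvd⟩ : ∃ f : F[X], f.degree < D ∧ Φ ∣ f₀ - f := by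
      refine ⟨f₀ % Φ, ?_, ?_⟩
      · rw [← degree_eq_natDegree hΦ0]
        exact degree_mod_lt _ hΦ0
      · exact ⟨f₀ / Φ, by rw [sub_eq_iff_eq_add, EuclideanDomain.div_add_mod]⟩
    have hf : ¬ Φ ∣ f := fun h' => hf₀ (by simpa using dvd_add hfdvd h')
    have hred : ∀ y, (f₀ * y * g) %ₘ (X ^ n - C μ) = (f * y * g) %ₘ (X ^ n - C μ) := by
      intro y
      refine modByMonic_eq_of_dvd_sub hmonic ?_
      obtain ⟨z, hz⟩ := hfdvd
      exact ⟨z * y, by rw [← sub_mul, ← sub_mul, hz, hN]; ring⟩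
    rw [hred, hred] at hle
    obtain ⟨S, hS, hSQ⟩ := exists_gcd_factorization hΦ0 hf
    set d := D - S.prod.natDegree with hd
    -- the windows are of average relative weight at most `δ`, so one of them is
    obtain ⟨i, hi, hile⟩ : ∃ i ∈ Finset.range n, ((W d f i x.1 + W d f i x.2 : ℕ) : ℝ) ≤
        δ * (Fintype.card (Fin d ⊕ Fin d)) := by
      refine Finset.exists_le_of_sum_le (Finset.nonempty_range_iff.2 hn.ne') ?_
      rw [← Nat.cast_sum, Finset.sum_add_distrib, sum_card_cyclic_window hn (hdeg_mod _),
        sum_card_cyclic_window hn (hdeg_mod _), ← mul_add]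
      simp only [Fintype.card_sum, Fintype.card_fin, Finset.sum_const, Finset.card_range,
        nsmul_eq_mul]
      rw [Nat.cast_mul]
      refine (mul_le_mul_of_nonneg_left hle (Nat.cast_nonneg d)).trans (le_of_eq ?_)
      push_cast
      ring
    simp only [Finset.mem_biUnion, Finset.mem_filter]
    refine ⟨S.prod, ?_, f, ⟨mem_lowDegree.2 hfdeg, hSQ⟩, i, hi, Finset.mem_filter.2 ⟨hx, hile⟩⟩
    rw [hE, Multiset.mem_toFinset]
    exact Multiset.mem_map.2 ⟨S, Multiset.mem_powerset.2 hS, rfl⟩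
  have hbad : ∀ e f i, Q e f → ((Bad e f i).card : ℝ) ≤
      (q : ℝ) ^ (2 * e.natDegree) * (q : ℝ) ^ (2 * ((D - e.natDegree : ℕ) : ℝ) * h) := by
    rintro e f i ⟨c, f', hc, hf', hcop, hu⟩
    have hc' : D - e.natDegree = c.natDegree := by
      rw [hD, hc, natDegree_mul (left_ne_zero_of_mul (hc ▸ hΦ0))
        (right_ne_zero_of_mul (hc ▸ hΦ0)), Nat.add_sub_cancel_left]
    simp only [hBad]
    rw [hc']
    have h1 := card_light_window_le hn hμ hN hc hf' hcop i
      (δ * (Fintype.card (Fin c.natDegree ⊕ Fin c.natDegree)))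
    have h2 := card_hammingNorm_le (ι := Fin c.natDegree ⊕ Fin c.natDegree) (F := F) hq2 hδ hδ1
    refine (Nat.cast_le.2 h1).trans ?_
    rw [Nat.cast_mul, Nat.cast_pow]
    refine mul_le_mul_of_nonneg_left (h2.trans (le_of_eq ?_)) (by positivity)
    congr 1
    rw [Fintype.card_sum, Fintype.card_fin]
    push_cast
    ring
  have hmain : ∀ e ∈ E, ((((lowDegree F D).filter (Q e)).biUnion fun f =>
      (Finset.range n).biUnion fun i => Bad e f i).card : ℝ) ≤
      (q : ℝ) ^ (2 * D) * (n * (q : ℝ) ^ (-(1 - 2 * h) * (n / B))) := by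
    intro e _
    rcases ((lowDegree F D).filter (Q e)).eq_empty_or_nonempty with hemp | ⟨f₁, hf₁⟩
    · rw [hemp, Finset.biUnion_empty, Finset.card_empty, Nat.cast_zero]
      positivity
    obtain ⟨c, f', hc, -, -, hu⟩ := (Finset.mem_filter.1 hf₁).2
    have he0 : e ≠ 0 := left_ne_zero_of_mul (hc ▸ hΦ0)
    have hc0 : c ≠ 0 := right_ne_zero_of_mul (hc ▸ hΦ0)
    have hsumdeg : D = e.natDegree + c.natDegree := by rw [hD, hc, natDegree_mul he0 hc0]
    have hc' : D - e.natDegree = c.natDegree := by omega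
    have hlarge : (n : ℝ) / B ≤ c.natDegree := by
      obtain ⟨P, hP, hPc⟩ := WfDvdMonoid.exists_irreducible_factor hu hc0
      rw [div_le_iff₀ (by positivity), mul_comm]
      have h1 := hB P hP (hPc.trans (hc ▸ dvd_mul_left c e))
      have h2 := natDegree_le_of_dvd hPc hc0
      exact_mod_cast h1.trans (Nat.mul_le_mul_left B h2)
    have hstep : ∀ f ∈ (lowDegree F D).filter (Q e),
        (((Finset.range n).biUnion fun i => Bad e f i).card : ℝ) ≤
        n * ((q : ℝ) ^ (2 * e.natDegree) * (q : ℝ) ^ (2 * (c.natDegree : ℝ) * h)) := by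
      intro f hf
      refine (Nat.cast_le.2 Finset.card_biUnion_le).trans ?_
      rw [Nat.cast_sum]
      refine (Finset.sum_le_card_nsmul _ _ _ fun i _ =>
        hbad e f i (Finset.mem_filter.1 hf).2).trans (le_of_eq ?_)
      rw [Finset.card_range, nsmul_eq_mul, hc']
    have hcardf : ((((lowDegree F D).filter (Q e)).card : ℕ) : ℝ) ≤ (q : ℝ) ^ c.natDegree := by
      have := card_filter_dvd_lowDegree_le (D := D) he0 (Q e)
        (fun f ⟨_, f', _, hf', _⟩ => hf' ▸ dvd_mul_right e f')
      rw [hc'] at this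
      exact_mod_cast this
    calc _ ≤ ((∑ f ∈ (lowDegree F D).filter (Q e),
            ((Finset.range n).biUnion fun i => Bad e f i).card : ℕ) : ℝ) :=
          Nat.cast_le.2 Finset.card_biUnion_le
      _ ≤ (q : ℝ) ^ c.natDegree * (n * ((q : ℝ) ^ (2 * e.natDegree) *
            (q : ℝ) ^ (2 * (c.natDegree : ℝ) * h))) := by
          rw [Nat.cast_sum]
          refine (Finset.sum_le_card_nsmul _ _ _ hstep).trans ?_
          rw [nsmul_eq_mul]
          exact mul_le_mul_of_nonneg_right hcardf (by positivity)
      _ = (q : ℝ) ^ (2 * D) * (n * (q : ℝ) ^ (-(1 - 2 * h) * c.natDegree)) := by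
          have : ∀ k : ℕ, (q : ℝ) ^ k = (q : ℝ) ^ (k : ℝ) := fun k => (Real.rpow_natCast _ _).symm
          rw [this, this, this, mul_left_comm, mul_left_comm _ (n : ℝ), ← Real.rpow_add hq0,
            ← Real.rpow_add hq0, ← Real.rpow_add hq0, hsumdeg]
          congr 2
          push_cast
          ring
      _ ≤ _ := by
          refine mul_le_mul_of_nonneg_left (mul_le_mul_of_nonneg_left ?_ (by positivity))
            (by positivity)
          refine Real.rpow_le_rpow_of_exponent_le hq1 ?_
          exact mul_le_mul_of_nonpos_left hlarge (by linarith)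
  have htot : (q : ℝ) ^ (2 * D) ≤
      (q : ℝ) ^ (2 * D) * (2 ^ B * (n * (q : ℝ) ^ (-(1 - 2 * h) * (n / B)))) := by
    calc (q : ℝ) ^ (2 * D) = (T.card : ℝ) := by
          rw [hT, Finset.card_product, card_lowDegree, mul_comm 2, pow_mul, sq]
          push_cast
          rfl
      _ ≤ ((∑ e ∈ E, (((lowDegree F D).filter (Q e)).biUnion fun f =>
            (Finset.range n).biUnion fun i => Bad e f i).card : ℕ) : ℝ) :=
          Nat.cast_le.2 ((Finset.card_le_card hcover).trans Finset.card_biUnion_le)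
      _ ≤ E.card * ((q : ℝ) ^ (2 * D) * (n * (q : ℝ) ^ (-(1 - 2 * h) * (n / B)))) := by
          rw [Nat.cast_sum]
          refine (Finset.sum_le_card_nsmul _ _ _ hmain).trans ?_
          rw [nsmul_eq_mul]
      _ ≤ 2 ^ B * ((q : ℝ) ^ (2 * D) * (n * (q : ℝ) ^ (-(1 - 2 * h) * (n / B)))) :=
          mul_le_mul_of_nonneg_right (by exact_mod_cast hEcard) (by positivity)
      _ = _ := by ring
  have hpos : (0 : ℝ) < (q : ℝ) ^ (2 * D) := by positivity
  nlinarith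

/-! ### Irreducible factors at prime power lengths -/

/-- Lifting the exponent: the order of `q` modulo `p ^ k` is at least `p ^ k / q ^ (p - 1)`. -/
theorem prime_pow_le_of_dvd_pow_sub_one {p q k d : ℕ} (hp : p.Prime) (hp2 : p ≠ 2) (hq : 2 ≤ q)
    (hpq : ¬ p ∣ q) (hd : 0 < d) (h : p ^ k ∣ q ^ d - 1) : p ^ k ≤ q ^ (p - 1) * d := by
  have : Fact p.Prime := ⟨hp⟩
  have hp3 : 2 < p := lt_of_le_of_ne hp.two_le (Ne.symm hp2)
  set x := q ^ (p - 1) with hx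
  have hx1 : 1 < x := Nat.one_lt_pow (by omega) hq
  have hpx : p ∣ x - 1 := by
    have := (Nat.ModEq.pow_totient ((Nat.Prime.coprime_iff_not_dvd hp).2 hpq).symm)
    rw [Nat.totient_prime hp] at this
    exact (Nat.modEq_iff_dvd' hx1.le).1 this.symm
  have hxd : p ^ k ∣ x ^ d - 1 ^ d := by
    rw [hx, ← pow_mul, mul_comm, pow_mul, one_pow]
    refine h.trans ?_
    simpa using Nat.sub_dvd_pow_sub_pow (q ^ d) 1 (p - 1)
  have hne : x ^ d - 1 ^ d ≠ 0 := by
    rw [one_pow]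
    have := Nat.one_lt_pow hd.ne' hx1
    omega
  have hv := padicValNat.pow_sub_pow (p := p) (hp.odd_of_ne_two hp2) hx1 hpx
    (fun h => hpq (hp.dvd_of_dvd_pow h)) hd.ne'
  have hk : k ≤ padicValNat p (x ^ d - 1 ^ d) := (padicValNat_dvd_iff_le hne).1 hxd
  calc p ^ k ≤ p ^ (padicValNat p (x - 1) + padicValNat p d) :=
        Nat.pow_le_pow_right hp.pos (hv ▸ hk)
    _ = p ^ padicValNat p (x - 1) * p ^ padicValNat p d := pow_add _ _ _
    _ ≤ x * d := Nat.mul_le_mul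
        ((Nat.le_of_dvd (by omega) pow_padicValNat_dvd).trans (Nat.sub_le _ _))
        (Nat.le_of_dvd hd pow_padicValNat_dvd)

/-- The irreducible factors of `(X ^ n - ν ^ n) / (X ^ (n / p) - ν ^ (n / p))`, `n = p ^ (k + 1)`,
have degree at least `n / q ^ (p - 1)`: the quotient of a root by `ν` has order `n`. -/
theorem prime_pow_le_natDegree {F : Type*} [Field F] [Fintype F] {p : ℕ} (hp : p.Prime)
    (hp2 : p ≠ 2) (hpq : ¬ p ∣ Fintype.card F) (k : ℕ) {ν : F} (hν : ν ≠ 0) {Φ P : F[X]}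
    (hN : X ^ p ^ (k + 1) - C (ν ^ p ^ (k + 1)) = (X ^ p ^ k - C (ν ^ p ^ k)) * Φ)
    (hP : Irreducible P) (hPΦ : P ∣ Φ) :
    p ^ (k + 1) ≤ Fintype.card F ^ (p - 1) * P.natDegree := by
  have : Fact (Irreducible P) := ⟨hP⟩
  have : Fact p.Prime := ⟨hp⟩
  have hfin : FiniteDimensional F (AdjoinRoot P) := (AdjoinRoot.powerBasis hP.ne_zero).finite
  have : Finite (AdjoinRoot P) := Module.finite_of_finite F
  have : Fintype (AdjoinRoot P) := Fintype.ofFinite _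
  have hcard : Fintype.card (AdjoinRoot P) = Fintype.card F ^ P.natDegree := by
    rw [Module.card_eq_pow_finrank (K := F), (AdjoinRoot.powerBasis hP.ne_zero).finrank,
      AdjoinRoot.powerBasis_dim]
  set i : F →+* AdjoinRoot P := AdjoinRoot.of P
  set β := AdjoinRoot.root P
  have hΦβ : Φ.eval₂ i β = 0 := by
    obtain ⟨c, rfl⟩ := hPΦ
    rw [eval₂_mul, AdjoinRoot.eval₂_root, zero_mul]
  have hiν : i ν ≠ 0 := (map_ne_zero i).2 hν
  have hβ : β ^ p ^ (k + 1) = i ν ^ p ^ (k + 1) := by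
    have := congrArg (eval₂ i β) hN
    rw [eval₂_mul, hΦβ, mul_zero, eval₂_sub, eval₂_X_pow, eval₂_C, sub_eq_zero, map_pow] at this
    exact this
  have hβ0 : β ≠ 0 := by
    intro h
    rw [h, zero_pow (pow_pos hp.pos _).ne'] at hβ
    exact pow_ne_zero _ hiν hβ.symm
  have hpF : (p : AdjoinRoot P) ≠ 0 := by
    intro h0
    have h1 : ((Fintype.card F : ℕ) : AdjoinRoot P) = 0 := by
      rw [← map_natCast i, FiniteField.cast_card_eq_zero, map_zero]
    have h2 := (Nat.isCoprime_iff_coprime.2 ((Nat.Prime.coprime_iff_not_dvd hp).2 hpq))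
    obtain ⟨x, y, hxy⟩ := h2
    have := congrArg (Int.cast : ℤ → AdjoinRoot P) hxy
    push_cast at this
    simp [h0, h1] at this
  have hsep : β ^ p ^ k ≠ i ν ^ p ^ k := by
    -- otherwise `β` would be a double root of the separable polynomial `X ^ n - ν ^ n`
    intro h
    have hgβ : eval₂ i β (X ^ p ^ k - C (ν ^ p ^ k)) = 0 := by
      rw [eval₂_sub, eval₂_X_pow, eval₂_C, map_pow, h, sub_self]
    have := congrArg (eval₂ i β) (congrArg derivative hN)
    rw [derivative_mul, eval₂_add, eval₂_mul, hΦβ, eval₂_mul, hgβ, mul_zero, zero_mul, add_zero,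
      derivative_sub, derivative_X_pow, derivative_C, sub_zero, eval₂_mul, eval₂_C,
      eval₂_X_pow, map_natCast] at this
    rcases mul_eq_zero.1 this with h' | h'
    · push_cast at h'
      exact pow_ne_zero _ hpF h'
    · exact pow_ne_zero _ hβ0 h'
  have hord : orderOf (β / i ν) = p ^ (k + 1) := by
    refine orderOf_eq_prime_pow ?_ ?_
    · rw [div_pow, div_eq_one_iff_eq (pow_ne_zero _ hiν)]
      exact hsep
    · rw [div_pow, div_eq_one_iff_eq (pow_ne_zero _ hiν)]
      exact hβ
  refine prime_pow_le_of_dvd_pow_sub_one hp hp2 Fintype.one_lt_card hpq hP.natDegree_pos ?_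
  rw [← hord, ← hcard]
  exact orderOf_dvd_of_pow_eq_one (FiniteField.pow_card_sub_one_eq_one _ (div_ne_zero hβ0 hiν))

/-- Heavy one-generator double constacyclic codes exist for some power `n` of any odd prime `p` not
dividing `q`. The power does not depend on `ν`, which the application lets vary with `n`. -/
theorem exists_prime_pow_heavy_pair {F : Type*} [Field F] [Fintype F] [DecidableEq F] {p : ℕ}
    (hp : p.Prime) (hp2 : p ≠ 2) (hpq : ¬ p ∣ Fintype.card F) {δ : ℝ} (hδ : 0 < δ)
    (hδ1 : δ ≤ 1 - 1 / (Fintype.card F : ℝ)) (hent : qEntropy (Fintype.card F) δ < 1 / 2) :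
    ∃ k, ∀ ν : F, ν ≠ 0 → ∃ g Φ a b : F[X],
      X ^ p ^ (k + 1) - C (ν ^ p ^ (k + 1)) = g * Φ ∧ g.natDegree = p ^ k ∧
      ∀ f : F[X], ¬ Φ ∣ f → 2 * (p ^ (k + 1) : ℕ) * δ <
        ((((f * a * g) %ₘ (X ^ p ^ (k + 1) - C (ν ^ p ^ (k + 1)))).support.card +
          ((f * b * g) %ₘ (X ^ p ^ (k + 1) - C (ν ^ p ^ (k + 1)))).support.card : ℕ) : ℝ) := by
  set q := Fintype.card F with hq
  set h := qEntropy q δ with hh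
  have hq2 : 2 ≤ q := Fintype.one_lt_card
  have hq0 : (0 : ℝ) < q := by positivity
  obtain ⟨B, hB⟩ : ∃ B, B = q ^ (p - 1) := ⟨_, rfl⟩
  have hB0 : 0 < B := hB ▸ by positivity
  have hlog : 0 < Real.log q := Real.log_pos (by exact_mod_cast hq2)
  have hc : 0 < Real.log q * (1 - 2 * h) / B :=
    div_pos (mul_pos hlog (by linarith)) (by exact_mod_cast hB0)
  have hpow : Tendsto (fun k : ℕ => p ^ (k + 1)) atTop atTop :=
    (tendsto_pow_atTop_atTop_of_one_lt hp.one_lt).comp (tendsto_add_atTop_nat 1)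
  have hlim : Tendsto (fun k : ℕ => 2 ^ B * (((p ^ (k + 1) : ℕ) : ℝ) *
      (q : ℝ) ^ (-(1 - 2 * h) * ((p ^ (k + 1) : ℕ) / B)))) atTop (𝓝 0) := by
    have h1 := (tendsto_rpow_mul_exp_neg_mul_atTop_nhds_zero 1 _ hc).comp
      (tendsto_natCast_atTop_atTop.comp hpow)
    rw [← mul_zero ((2 : ℝ) ^ B)]
    refine (h1.congr fun k => ?_).const_mul _
    simp only [Function.comp_apply]
    rw [Real.rpow_one, Real.rpow_def_of_pos hq0]
    congr 2
    ring
  obtain ⟨k, hk⟩ := (hlim.eventually_lt_const one_pos).exists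
  refine ⟨k, fun ν hν => ?_⟩
  obtain ⟨Φ, hΦ⟩ : (X ^ p ^ k - C (ν ^ p ^ k) : F[X]) ∣
      X ^ p ^ (k + 1) - C (ν ^ p ^ (k + 1)) := by
    have := sub_dvd_pow_sub_pow (X ^ p ^ k) (C (ν ^ p ^ k)) p
    rwa [← pow_mul, ← C_pow, ← pow_mul, ← pow_succ p k] at this
  have hfactor : ∀ P : F[X], Irreducible P → P ∣ Φ → p ^ (k + 1) ≤ B * P.natDegree :=
    fun P hP hPΦ => by
      rw [hB]
      exact prime_pow_le_natDegree hp hp2 hpq k hν hΦ hP hPΦ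
  obtain ⟨a, b, hab⟩ := exists_heavy_pair (pow_pos hp.pos (k + 1)) hB0 (pow_ne_zero _ hν) hΦ
    hfactor hδ hδ1 hent hk
  exact ⟨_, Φ, a, b, hΦ, natDegree_X_pow_sub_C, hab⟩

/-! ### Repetition and the socle -/

/-- The product concatenates `m` nonzero multiples of the word `v` of length `n`. -/
theorem degree_lt_and_card_support_mul_blocks {F : Type*} [Field F] {n : ℕ} {v : F[X]}
    (hv : v.degree < n) (c : ℕ → F) (hc : ∀ j, c j ≠ 0) (m : ℕ) :
    (v * ∑ j ∈ Finset.range m, C (c j) * X ^ (n * j)).degree < (n * m : ℕ) ∧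
      (v * ∑ j ∈ Finset.range m, C (c j) * X ^ (n * j)).support.card = m * v.support.card := by
  classical
  induction m with
  | zero => simp
  | succ m ih =>
    obtain ⟨ih1, ih2⟩ := ih
    rw [Finset.sum_range_succ, mul_add]
    set P := v * ∑ j ∈ Finset.range m, C (c j) * X ^ (n * j)
    have hcoeff : ∀ k, (v * (C (c m) * X ^ (n * m))).coeff k =
        if n * m ≤ k then v.coeff (k - n * m) * c m else 0 := by
      intro k
      rw [← mul_assoc, coeff_mul_X_pow']
      simp [coeff_mul_C]
    have hPz : ∀ k, n * m ≤ k → P.coeff k = 0 := fun k hk =>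
      coeff_eq_zero_of_degree_lt (ih1.trans_le (by exact_mod_cast hk))
    have hvz : ∀ k, n ≤ k → v.coeff k = 0 := fun k hk =>
      coeff_eq_zero_of_degree_lt (hv.trans_le (by exact_mod_cast hk))
    constructor
    · rw [degree_lt_iff_coeff_zero]
      intro k hk
      rw [mul_add, mul_one] at hk
      rw [coeff_add, hcoeff, if_pos (by omega), hPz k (by omega), hvz _ (by omega), zero_mul,
        add_zero]
    · have hsupp : (P + v * (C (c m) * X ^ (n * m))).support =
          P.support ∪ v.support.image (· + n * m) := by
        ext k
        simp only [mem_support_iff, coeff_add, hcoeff, Finset.mem_union, Finset.mem_image]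
        rcases lt_or_ge k (n * m) with hk | hk
        · rw [if_neg (by omega), add_zero]
          refine ⟨Or.inl, fun h => h.resolve_right ?_⟩
          rintro ⟨y, -, rfl⟩
          omega
        · rw [if_pos hk, hPz k hk, zero_add]
          constructor
          · intro h
            exact Or.inr ⟨k - n * m, left_ne_zero_of_mul h, by omega⟩
          · rintro (h | ⟨y, hy, rfl⟩)
            · exact absurd rfl h
            · rw [Nat.add_sub_cancel]
              exact mul_ne_zero hy (hc m)
      rw [hsupp, Finset.card_union_of_disjoint, ih2,
        Finset.card_image_of_injective _ (add_left_injective _)]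
      · ring
      · rw [Finset.disjoint_left]
        rintro k hk hk'
        obtain ⟨y, -, rfl⟩ := Finset.mem_image.1 hk'
        exact mem_support_iff.1 hk (hPz _ (by omega))

/-- Multiplication by `(X ^ (m n) - μ ^ m) / (X ^ n - μ)` repeats a word `m` times, up to nonzero
factors. -/
theorem exists_repetition {F : Type*} [Field F] {n m : ℕ} (hn : 0 < n) (hm : 0 < m) {μ : F}
    (hμ : μ ≠ 0) : ∃ E : F[X], ∀ u : F[X],
      ((u * E) %ₘ (X ^ (m * n) - C (μ ^ m))).support.card =
        m * (u %ₘ (X ^ n - C μ)).support.card := by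
  set E : F[X] := ∑ j ∈ Finset.range m, C (μ ^ (m - 1 - j)) * X ^ (n * j) with hE
  have hmul : (X ^ (m * n) - C (μ ^ m) : F[X]) = E * (X ^ n - C μ) := by
    rw [mul_comm m, pow_mul, C_pow, ← geom_sum₂_mul]
    congr 1
    refine Finset.sum_congr rfl fun j _ => ?_
    rw [pow_mul, C_pow, mul_comm]
  have hmonic : (X ^ n - C μ).Monic := monic_X_pow_sub_C μ hn.ne'
  have hmonic' : (X ^ (m * n) - C (μ ^ m)).Monic :=
    monic_X_pow_sub_C _ (Nat.mul_pos hm hn).ne'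
  refine ⟨E, fun u => ?_⟩
  have hv : (u %ₘ (X ^ n - C μ)).degree < n := by
    have := degree_modByMonic_lt u hmonic
    rwa [degree_X_pow_sub_C hn] at this
  obtain ⟨h1, h2⟩ := degree_lt_and_card_support_mul_blocks hv (fun j => μ ^ (m - 1 - j))
    (fun j => pow_ne_zero _ hμ) m
  have h3 : (u * E) %ₘ (X ^ (m * n) - C (μ ^ m)) =
      ((u %ₘ (X ^ n - C μ)) * E) %ₘ (X ^ (m * n) - C (μ ^ m)) := by
    refine modByMonic_eq_of_dvd_sub hmonic' ?_
    rw [← sub_mul, modByMonic_eq_sub_mul_div, sub_sub_cancel, hmul]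
    exact ⟨u /ₘ (X ^ n - C μ), by ring⟩
  rw [h3, (modByMonic_eq_self_iff hmonic').2, h2]
  rw [degree_X_pow_sub_C (Nat.mul_pos hm hn), mul_comm m]
  exact h1

/-- Multiplying by an element whose annihilator is the radical turns polynomials over `R` into
copies of their reductions over the residue field, with the same Hamming weights. The ring `S` is
reached from `R` through `σ`, so that both components of a double constacyclic code are covered. -/
theorem hammingNorm_word_socle {R S F : Type*} [CommRing R] [CommRing S] [Field F]
    [DecidableEq S] (σ : R →+* S) (π : R →+* F) {s : S} (hs : ∀ x, s * σ x = 0 ↔ π x = 0)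
    (a : R) {m : ℕ} (hm : 0 < m) (u : R[X]) :
    hammingNorm (ConstacyclicRing.word
      (AdjoinRoot.mk (X ^ m - C (σ a)) (C s * u.map σ) : ConstacyclicRing S (σ a) m)) =
      ((u.map π) %ₘ (X ^ m - C (π a))).support.card := by
  have hmonic : (X ^ m - C a).Monic := monic_X_pow_sub_C a hm.ne'
  have hcoeff : ∀ k, ((C s * u.map σ) %ₘ (X ^ m - C (σ a))).coeff k =
      s * σ ((u %ₘ (X ^ m - C a)).coeff k) := by
    intro k
    rw [← smul_eq_C_mul, smul_modByMonic, coeff_smul, smul_eq_mul, ← coeff_map,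
      map_modByMonic _ hmonic]
    simp
  have hcoeff' : ∀ k, ((u.map π) %ₘ (X ^ m - C (π a))).coeff k =
      π ((u %ₘ (X ^ m - C a)).coeff k) := by
    intro k
    rw [← coeff_map, map_modByMonic _ hmonic]
    simp
  have hdeg : ((u.map π) %ₘ (X ^ m - C (π a))).degree < m := by
    have := degree_modByMonic_lt (u.map π) (monic_X_pow_sub_C (π a) hm.ne')
    rwa [degree_X_pow_sub_C hm] at this
  rw [hammingNorm]
  refine Finset.card_bij (fun i _ => (i : ℕ)) ?_ (fun _ _ _ _ h => Fin.ext h) ?_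
  · intro i hi
    rw [mem_support_iff, hcoeff']
    have := (Finset.mem_filter.1 hi).2
    rw [ConstacyclicRing.word, AdjoinRoot.modByMonicHom_mk, hcoeff] at this
    exact fun h => this ((hs _).2 h)
  · intro k hk
    have hkm : k < m := by
      by_contra h
      exact mem_support_iff.1 hk (coeff_eq_zero_of_degree_lt
        (hdeg.trans_le (by exact_mod_cast not_lt.1 h)))
    refine ⟨⟨k, hkm⟩, Finset.mem_filter.2 ⟨Finset.mem_univ _, ?_⟩, rfl⟩
    rw [ConstacyclicRing.word, AdjoinRoot.modByMonicHom_mk, hcoeff]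
    rw [mem_support_iff, hcoeff'] at hk
    exact fun h => hk ((hs _).1 h)

theorem hammingNorm_word_eq_zero_iff {S : Type*} [CommRing S] [Nontrivial S] [DecidableEq S] {a : S}
    {m : ℕ} (hm : 0 < m) {c : ConstacyclicRing S a m} :
    hammingNorm (ConstacyclicRing.word c) = 0 ↔ c = 0 := by
  have hmonic : (X ^ m - C a).Monic := monic_X_pow_sub_C a hm.ne'
  rw [hammingNorm_eq_zero]
  constructor
  · intro h
    obtain ⟨u, rfl⟩ := AdjoinRoot.mk_surjective c
    rw [AdjoinRoot.mk_eq_zero, ← modByMonic_eq_zero_iff_dvd hmonic]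
    ext k
    rcases lt_or_ge k m with hk | hk
    · have := congrFun h ⟨k, hk⟩
      rwa [ConstacyclicRing.word, AdjoinRoot.modByMonicHom_mk] at this
    · refine coeff_eq_zero_of_degree_lt ((degree_modByMonic_lt u hmonic).trans_le ?_)
      rw [degree_X_pow_sub_C hm]
      exact_mod_cast hk
  · rintro rfl
    ext i
    rw [ConstacyclicRing.word, map_zero]
    rfl

theorem isNilpotent_maximalIdeal (R : Type*) [CommRing R] [IsLocalRing R] [Finite R] :
    IsNilpotent (IsLocalRing.maximalIdeal R) := by
  rw [← IsLocalRing.jacobson_eq_maximalIdeal ⊥ bot_ne_top]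
  exact IsArtinianRing.isNilpotent_jacobson_bot

theorem radicalIndex_pos (R : Type*) [CommRing R] [IsLocalRing R] [Finite R] :
    0 < radicalIndex R :=
  pos_nilpotencyClass_iff.2 (isNilpotent_maximalIdeal R)

/-- A finite local ring has an element whose annihilator is the maximal ideal: any nonzero element
of the last nonzero power of the radical. -/
theorem exists_mul_eq_zero_iff_mem_maximalIdeal (R : Type*) [CommRing R] [IsLocalRing R]
    [Finite R] : ∃ s : R, ∀ x, s * x = 0 ↔ x ∈ IsLocalRing.maximalIdeal R := by
  have hnil := isNilpotent_maximalIdeal R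
  obtain ⟨s, hs, hs0⟩ := Submodule.exists_mem_ne_zero_of_ne_bot (pow_pred_nilpotencyClass hnil)
  refine ⟨s, fun x => ⟨fun h => ?_, fun hx => ?_⟩⟩
  · by_contra hx
    rw [IsLocalRing.mem_maximalIdeal, mem_nonunits_iff, not_not] at hx
    exact hs0 (hx.mul_left_eq_zero.1 h)
  · have := Ideal.mul_mem_mul hs hx
    rw [← pow_succ, Nat.sub_add_cancel (pos_nilpotencyClass_iff.2 hnil),
      pow_nilpotencyClass hnil] at this
    simpa using this

/-! ### Double constacyclic codes over the two rings -/

/-- A one-generator code over the residue field, repeated to the cycle lengths `α' n` and `α n`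
and moved into the socles of `R'` and `R`, becomes a double constacyclic code of the same size,
whose weights grow at least by the factor `min α' α`. -/
theorem exists_double_constacyclic_code {R R' : Type*} [CommRing R] [CommRing R']
    [IsLocalRing R] [IsLocalRing R'] [Finite R] [Finite R'] (ρ : R →+* R')
    (hρ : Function.Surjective ρ) (a : R) {α' α n : ℕ} (hα' : 0 < α') (hα : 0 < α) (hn : 0 < n)
    {μ : IsLocalRing.ResidueField R} (hμ : μ ≠ 0) (hμα' : μ ^ α' = IsLocalRing.residue R a)
    (hμα : μ ^ α = IsLocalRing.residue R a) {g Φ b' b : (IsLocalRing.ResidueField R)[X]}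
    (hN : X ^ n - C μ = g * Φ) (hΦ : 0 < Φ.natDegree) {w : ℝ} (hw0 : 0 ≤ w)
    (hw : ∀ f, ¬ Φ ∣ f → w < ((((f * b' * g) %ₘ (X ^ n - C μ)).support.card +
      ((f * b * g) %ₘ (X ^ n - C μ)).support.card : ℕ) : ℝ)) :
    ∃ K : DoubleConstacyclicCode ρ a (α' * n) (α * n),
      Nat.card K = residueCard R ^ Φ.natDegree ∧ (min α' α : ℕ) * w < K.minWeight := by
  classical
  set π := IsLocalRing.residue R with hπ
  have hlocal : IsLocalHom ρ := .of_surjective ρ hρ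
  obtain ⟨s, hs⟩ := exists_mul_eq_zero_iff_mem_maximalIdeal R
  obtain ⟨s', hs'⟩ := exists_mul_eq_zero_iff_mem_maximalIdeal R'
  have hsπ : ∀ x, s * RingHom.id R x = 0 ↔ π x = 0 := fun x => by
    rw [RingHom.id_apply, hs, IsLocalRing.residue_eq_zero_iff]
  have hsπ' : ∀ x, s' * ρ x = 0 ↔ π x = 0 := fun x => by
    rw [hs', IsLocalRing.residue_eq_zero_iff, IsLocalRing.mem_maximalIdeal,
      IsLocalRing.mem_maximalIdeal, mem_nonunits_iff, mem_nonunits_iff, isUnit_map_iff]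
  obtain ⟨E', hE'⟩ := exists_repetition hn hα' hμ
  obtain ⟨E, hE⟩ := exists_repetition hn hα hμ
  have hlift := map_surjective π IsLocalRing.residue_surjective
  obtain ⟨A', hA'⟩ := hlift (b' * g * E')
  obtain ⟨A, hA⟩ := hlift (b * g * E)
  have hm' : 0 < α' * n := Nat.mul_pos hα' hn
  have hm : 0 < α * n := Nat.mul_pos hα hn
  set G : DoubleConstacyclicModule ρ a (α' * n) (α * n) :=
    (AdjoinRoot.mk _ (C s' * A'.map ρ), AdjoinRoot.mk _ (C s * A)) with hG
  have hsmul : ∀ f : R[X], f • G =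
      (AdjoinRoot.mk _ (C s' * (f * A').map ρ), AdjoinRoot.mk _ (C s * (f * A))) := by
    intro f
    rw [DoubleConstacyclicModule.smul_def, hG, ← map_mul, ← map_mul, Polynomial.map_mul,
      mul_left_comm, mul_left_comm f]
  have hw1 : ∀ f : R[X], hammingNorm (ConstacyclicRing.word (f • G).1) =
      α' * ((f.map π * b' * g) %ₘ (X ^ n - C μ)).support.card := by
    intro f
    have := hammingNorm_word_socle ρ π hsπ' a hm' (f * A')
    rw [hsmul, this, ← hμα', Polynomial.map_mul, hA', ← hE']
    simp only [mul_assoc]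
  have hw2 : ∀ f : R[X], hammingNorm (ConstacyclicRing.word (f • G).2) =
      α * ((f.map π * b * g) %ₘ (X ^ n - C μ)).support.card := by
    intro f
    have := hammingNorm_word_socle (RingHom.id R) π hsπ a hm (f * A)
    rw [Polynomial.map_id] at this
    rw [hsmul]
    refine this.trans ?_
    rw [← hμα, Polynomial.map_mul, hA, ← hE]
    simp only [mul_assoc]
  have hweight : ∀ f : R[X], (f • G).weight =
      α' * ((f.map π * b' * g) %ₘ (X ^ n - C μ)).support.card +
      α * ((f.map π * b * g) %ₘ (X ^ n - C μ)).support.card := by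
    intro f
    rw [← hw1, ← hw2, DoubleConstacyclicModule.weight]
  have hheavy : ∀ f : R[X], ¬ Φ ∣ f.map π → (min α' α : ℕ) * w < (f • G).weight := by
    intro f hf
    rw [hweight]
    refine (mul_lt_mul_of_pos_left (hw _ hf)
      (by exact_mod_cast lt_min hα' hα : (0 : ℝ) < (min α' α : ℕ))).trans_le ?_
    rw [← Nat.cast_mul, Nat.cast_le, mul_add]
    exact Nat.add_le_add (Nat.mul_le_mul_right _ (min_le_left _ _))
      (Nat.mul_le_mul_right _ (min_le_right _ _))
  have hmonic : (X ^ n - C μ).Monic := monic_X_pow_sub_C μ hn.ne'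
  have hker : ∀ f : R[X], f • G = 0 ↔ Φ ∣ f.map π := by
    intro f
    constructor
    · intro h
      by_contra hf
      have h1 := hheavy f hf
      have h2 : (f • G).weight = 0 := by
        rw [DoubleConstacyclicModule.weight, Nat.add_eq_zero_iff, h]
        exact ⟨(hammingNorm_word_eq_zero_iff hm').2 rfl, (hammingNorm_word_eq_zero_iff hm).2 rfl⟩
      rw [h2, Nat.cast_zero] at h1
      exact absurd h1 (not_lt.2 (by positivity))
    · rintro ⟨z, hz⟩
      have hzero : ∀ y, (f.map π * y * g) %ₘ (X ^ n - C μ) = 0 := by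
        intro y
        rw [modByMonic_eq_zero_iff_dvd hmonic, hN, hz]
        exact ⟨z * y, by ring⟩
      refine Prod.ext ?_ ?_
      · refine (hammingNorm_word_eq_zero_iff hm').1 ?_
        rw [hw1, hzero, support_zero, Finset.card_empty, mul_zero]
      · refine (hammingNorm_word_eq_zero_iff hm).1 ?_
        rw [hw2, hzero, support_zero, Finset.card_empty, mul_zero]
  have hΦ0 : Φ ≠ 0 := by rintro rfl; simp at hΦ
  refine ⟨Submodule.span R[X] {G}, ?_, ?_⟩
  · set φ : R[X] →+ AdjoinRoot Φ := ((AdjoinRoot.mk Φ).comp (mapRingHom π)).toAddMonoidHom with hφ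
    have hφs : Function.Surjective φ := AdjoinRoot.mk_surjective.comp hlift
    set ψ : R[X] →+ DoubleConstacyclicModule ρ a (α' * n) (α * n) :=
      (LinearMap.toSpanSingleton R[X] _ G).toAddMonoidHom with hψ
    have hkers : ψ.ker = φ.ker := by
      ext f
      rw [AddMonoidHom.mem_ker, AddMonoidHom.mem_ker]
      exact (hker f).trans AdjoinRoot.mk_eq_zero.symm
    have e := ((QuotientAddGroup.quotientKerEquivRange ψ).symm.trans
      (QuotientAddGroup.quotientAddEquivOfEq hkers)).trans
      (QuotientAddGroup.quotientKerEquivOfSurjective φ hφs)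
    have hrange : ∀ c, c ∈ Submodule.span R[X] {G} ↔ c ∈ ψ.range := by
      intro c
      rw [Submodule.mem_span_singleton]
      rfl
    have : Module.Finite (IsLocalRing.ResidueField R) (AdjoinRoot Φ) :=
      (AdjoinRoot.powerBasis hΦ0).finite
    calc Nat.card (Submodule.span R[X] {G}) = Nat.card ψ.range :=
          Nat.card_congr (Equiv.subtypeEquivRight hrange)
      _ = Nat.card (AdjoinRoot Φ) := Nat.card_congr e.toEquiv
      _ = _ := by
        rw [Module.natCard_eq_pow_finrank (K := IsLocalRing.ResidueField R),
          (AdjoinRoot.powerBasis hΦ0).finrank, AdjoinRoot.powerBasis_dim, residueCard]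
  · have hne : {k | ∃ c ∈ Submodule.span R[X] {G}, c ≠ 0 ∧ c.weight = k}.Nonempty := by
      refine ⟨_, G, Submodule.mem_span_singleton_self G, ?_, rfl⟩
      have h1 := (hker 1).not.2 (by
        rw [Polynomial.map_one]
        exact fun h => hΦ.ne' (natDegree_eq_zero_of_isUnit (isUnit_of_dvd_one h)))
      rwa [one_smul] at h1
    obtain ⟨c, hc, hc0, hcw⟩ := Nat.sInf_mem hne
    rw [DoubleConstacyclicCode.minWeight, ← hcw]
    obtain ⟨f, rfl⟩ := Submodule.mem_span_singleton.1 hc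
    exact hheavy f ((hker f).not.1 hc0)

/-! ### Asymptotics -/

theorem theorem4p2 {R R' : Type*} [CommRing R] [CommRing R']
    [IsFiniteChainRing R] [IsFiniteChainRing R']
    (ρ : R →+* R') (hρ : Function.Surjective ρ) (lam : Rˣ)
    (α' α : ℕ) (hα' : 0 < α') (hα : 0 < α)
    (hmod : α' ≡ α [MOD residueOrder lam]) (hgcd : Nat.gcd α (residueOrder lam) = 1)
    (δ : ℝ) (hδ_pos : 0 < δ) (hδ_lt : δ < 1 - 1 / (residueCard R : ℝ))
    (hdom : ((α' : ℝ) + α) / (2 * (min α' α : ℕ)) * δ ≤ 1 - 1 / (residueCard R : ℝ))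
    (hent : qEntropy (residueCard R) (((α' : ℝ) + α) / (2 * (min α' α : ℕ)) * δ) < 1 / 2) :
    ∃ (n : ℕ → ℕ)
      (K : ∀ i, DoubleConstacyclicCode ρ (lam : R) (α' * n i) (α * n i)),
      (∀ i, 0 < n i ∧ Nat.gcd (n i) (residueCard R * residueOrder lam) = 1) ∧
      Tendsto (fun i => (K i).length) atTop atTop ∧
      Tendsto (fun i => (K i).rate) atTop
        (𝓝 (1 / ((α' : ℝ) * radicalIndex R' + α * radicalIndex R))) ∧
      ∀ i, ((α' : ℝ) + α) / (α' * radicalIndex R' + α * radicalIndex R) * δ < (K i).relDist := by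
  classical
  have : Finite R := IsFiniteChainRing.finite
  have : Finite R' := IsFiniteChainRing.finite
  have : Finite (IsLocalRing.ResidueField R) :=
    Finite.of_surjective _ IsLocalRing.residue_surjective
  have := Fintype.ofFinite (IsLocalRing.ResidueField R)
  have hqc : residueCard R = Fintype.card (IsLocalRing.ResidueField R) :=
    Nat.card_eq_fintype_card
  set q := residueCard R with hq
  have hq2 : 2 ≤ q := hqc ▸ Fintype.one_lt_card
  set x := Units.map (IsLocalRing.residue R : R →* IsLocalRing.ResidueField R) lam with hx
  set t := residueOrder lam with ht
  have htx : t = orderOf x := rfl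
  have ht0 : 0 < t := htx ▸ orderOf_pos x
  have hℓ : 0 < radicalIndex R := radicalIndex_pos R
  have hℓ' : 0 < radicalIndex R' := radicalIndex_pos R'
  set δ' := ((α' : ℝ) + α) / (2 * (min α' α : ℕ)) * δ with hδ'
  have hmin : 0 < min α' α := lt_min hα' hα
  have hδ'_pos : 0 < δ' := by
    have : (0 : ℝ) < (min α' α : ℕ) := by exact_mod_cast hmin
    have : (0 : ℝ) < α' := by exact_mod_cast hα'
    positivity
  set L := α' * radicalIndex R' + α * radicalIndex R with hL
  have hL0 : 0 < L := by positivity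
  have hLcast : (α' : ℝ) * radicalIndex R' + α * radicalIndex R = L := by push_cast [hL]; ring
  -- A prime `p ≥ i` makes the rate converge; `p > q` and `p > t` give coprimality to `q t`, and
  -- `p > q ≥ 2` makes `p` odd.
  have key : ∀ i : ℕ, ∃ p k : ℕ, p.Prime ∧ i ≤ p ∧
      Nat.gcd (p ^ (k + 1)) (q * t) = 1 ∧ ∃ K : DoubleConstacyclicCode ρ (lam : R)
        (α' * p ^ (k + 1)) (α * p ^ (k + 1)), Nat.card K = q ^ (p ^ (k + 1) - p ^ k) ∧
        (min α' α : ℕ) * (2 * (p ^ (k + 1) : ℕ) * δ') < K.minWeight := by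
    intro i
    obtain ⟨p, hpge, hp⟩ := Nat.exists_infinite_primes (q + t + i + 1)
    have hpq : ¬ p ∣ q := fun h => by have := Nat.le_of_dvd (by omega) h; omega
    have hpt : ¬ p ∣ t := fun h => by have := Nat.le_of_dvd ht0 h; omega
    obtain ⟨k, hk⟩ := exists_prime_pow_heavy_pair (F := IsLocalRing.ResidueField R) hp
      (by omega) (hqc ▸ hpq) hδ'_pos (hqc ▸ hdom) (hqc ▸ hent)
    set n := p ^ (k + 1) with hn
    have hn0 : 0 < n := pow_pos hp.pos _
    have hcopt : Nat.Coprime n t := ((Nat.Prime.coprime_iff_not_dvd hp).2 hpt).pow_left _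
    have hcopq : Nat.Coprime n q := ((Nat.Prime.coprime_iff_not_dvd hp).2 hpq).pow_left _
    have hcop : (α * n).Coprime (orderOf x) := Nat.Coprime.mul_left hgcd hcopt
    obtain ⟨m, hm⟩ := exists_pow_eq_self_of_coprime hcop
    set ν : (IsLocalRing.ResidueField R)ˣ := x ^ m with hν
    have hν1 : ν ^ (α * n) = x := by rw [hν, ← pow_mul, mul_comm, pow_mul, hm]
    have hν2 : ν ^ (α' * n) = x := by
      rw [← hν1, pow_eq_pow_iff_modEq]
      exact (hmod.mul_right n).of_dvd (htx ▸ orderOf_pow_dvd m)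
    have hμ : ∀ β, ν ^ (β * n) = x →
        ((ν : IsLocalRing.ResidueField R) ^ n) ^ β = IsLocalRing.residue R lam := by
      intro β hβ
      rw [← pow_mul, mul_comm, ← Units.val_pow_eq_pow_val, hβ]
      rfl
    obtain ⟨g, Φ, b', b, hN, hg, hheavy⟩ := hk ν ν.ne_zero
    have hdegN : n = p ^ k + Φ.natDegree := by
      have hne : g * Φ ≠ 0 := hN ▸ X_pow_sub_C_ne_zero hn0 _
      rw [← hg, ← natDegree_mul (left_ne_zero_of_mul hne) (right_ne_zero_of_mul hne), ← hN,
        natDegree_X_pow_sub_C]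
    have hlt : p ^ k < n := Nat.pow_lt_pow_right hp.one_lt (Nat.lt_succ_self k)
    obtain ⟨K, hK1, hK2⟩ := exists_double_constacyclic_code ρ hρ (lam : R) hα' hα hn0
      (pow_ne_zero n ν.ne_zero) (hμ α' hν2) (hμ α hν1) hN (by omega)
      (w := 2 * (n : ℕ) * δ') (by positivity) hheavy
    refine ⟨p, k, hp, by omega, Nat.Coprime.mul_right hcopq hcopt, K, ?_, hK2⟩
    rw [hK1, show Φ.natDegree = n - p ^ k by omega]
  choose p k hp hpi hgcdn K hKcard hKw using key
  have hlen : ∀ i, (K i).length = p i ^ (k i + 1) * L := by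
    intro i
    rw [DoubleConstacyclicCode.length, hL]
    ring
  have hn0 : ∀ i, 0 < p i ^ (k i + 1) := fun i => pow_pos (hp i).pos _
  refine ⟨fun i => p i ^ (k i + 1), K, fun i => ⟨hn0 i, hgcdn i⟩, ?_, ?_, ?_⟩
  · refine tendsto_atTop_mono (fun i => ?_) tendsto_id
    rw [hlen]
    calc i ≤ p i := hpi i
      _ ≤ p i ^ (k i + 1) := Nat.le_self_pow (by omega) _
      _ ≤ _ := Nat.le_mul_of_pos_right _ hL0
  · have hrate : ∀ i, (K i).rate = (1 - 1 / (p i : ℝ)) * (1 / (L : ℝ)) := by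
      intro i
      have hp0 : (0 : ℝ) < p i := by exact_mod_cast (hp i).pos
      have hLr : (0 : ℝ) < L := by exact_mod_cast hL0
      have hlogq : Real.log q ≠ 0 := (Real.log_pos (by exact_mod_cast hq2)).ne'
      rw [DoubleConstacyclicCode.rate, hlen, hKcard, Nat.cast_pow, Real.logb_pow, Real.logb,
        div_self hlogq, mul_one,
        Nat.cast_sub (show p i ^ k i ≤ p i ^ (k i + 1) from
          Nat.pow_le_pow_right (hp i).pos (Nat.le_succ _))]
      push_cast
      field_simp
      ring
    simp_rw [hrate]
    rw [hLcast]
    have hp_tendsto : Tendsto (fun i => (p i : ℝ)) atTop atTop :=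
      tendsto_natCast_atTop_atTop.comp (tendsto_atTop_mono hpi tendsto_id)
    have h1 := (tendsto_const_nhds (x := (1 : ℝ))).sub
      ((tendsto_const_nhds (x := (1 : ℝ))).div_atTop hp_tendsto)
    have h2 := h1.mul_const (1 / (L : ℝ))
    rwa [sub_zero, one_mul] at h2
  · intro i
    have hLr : (0 : ℝ) < L := by exact_mod_cast hL0
    have hnr : (0 : ℝ) < (p i ^ (k i + 1) : ℕ) := by exact_mod_cast hn0 i
    have hminr : (0 : ℝ) < (min α' α : ℕ) := by exact_mod_cast hmin
    rw [DoubleConstacyclicCode.relDist, hlen, hLcast, Nat.cast_mul, lt_div_iff₀ (by positivity)]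
    refine lt_of_eq_of_lt ?_ (hKw i)
    rw [hδ']
    field_simp
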